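/- An index is a tuple of positive integers $(k_1,\dots,k_r)$ with $r\ge 1$. For an index with $k_1\ge 2$, let $$\zeta(k_1,\dots,k_r)=\sum_{n_1>\cdots>n_r\ge 1}\frac{1}{n_1^{k_1}\cdots n_r^{k_r}}$$ be the multiple zeta value. Hoffman's dual index of an index $\mathbf{k}=(k_1,\dots,k_r)$ is $$\mathbf{k}^{\vee}=(\underbrace{1,\dots,1}_{k_1}+\underbrace{1,\dots,1}_{k_2}+1,\dots,1+\underbrace{1,\dots,1}_{k_r}),$$ that is, one writes each $k_i$ as a sum $1+\cdots+1$ of $k_i$ ones and then interchanges all commas and plus signs. Theorem (Ohno type relation for multiple zeta values). For every $r\ge 1$, every $(k_1,\dots,k_r)\in\mathbb{Z}_{\ge 1}^r$ and every $m\in\mathbb{Z}_{\ge 0}$, $$\sum_{\substack{e_1+\cdots+e_r=m\\ e_i\ge 0\ (1\le i\le r)}}\zeta(k_1+e_1+1,k_2+e_2,\dots,k_r+e_r)=\sum_{\substack{e'_1+\cdots+e'_{r'}=m\\ e'_i\ge 0\ (1\le i\le r')}}\zeta\bigl((1,k'_1+e'_1,\dots,k'_{r'}+e'_{r'})^{\vee}\bigr),$$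 where $(k'_1,\dots,k'_{r'})=(k_1,\dots,k_r)^{\vee}$ is Hoffman's dual index of $(k_1,\dots,k_r)$. -/

import Mathlib

/-- The multiple zeta value `ζ(k₁, …, kᵣ) = ∑_{n₁ > ⋯ > nᵣ ≥ 1} 1 / (n₁^{k₁} ⋯ nᵣ^{kᵣ})`.
The series converges whenever all `kᵢ ≥ 1` and `k₁ ≥ 2`. -/
noncomputable def mzv (k : List ℕ) : ℝ :=
  ∑' n : {n : Fin k.length → ℕ // StrictAnti n ∧ ∀ i, 1 ≤ n i},
    ∏ i, 1 / (n.1 i : ℝ) ^ k.get i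

theorem summable_prod_tuple (g : ℕ → ℝ) (hg : Summable g) (h0 : ∀ n, 0 ≤ g n) (r : ℕ) :
    Summable (fun n : Fin r → ℕ => ∏ i, g (n i)) := by
  induction r with
  | zero => exact Summable.of_finite
  | succ r ih =>
    rw [← (Fin.consEquiv (fun _ : Fin (r+1) => ℕ)).summable_iff]
    have := hg.mul_of_nonneg ih h0 (fun n => Finset.prod_nonneg fun i _ => h0 _)
    refine this.congr fun x => ?_
    simp [Fin.prod_univ_succ, Fin.consEquiv]

/-- The series defining `mzv k` converges for every admissible index `k`. -/
theorem mzv_summable (k : List ℕ) (hpos : ∀ a ∈ k, 1 ≤ a) (h2 : ∀ a ∈ k.head?, 2 ≤ a) :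
    Summable fun n : {n : Fin k.length → ℕ // StrictAnti n ∧ ∀ i, 1 ≤ n i} =>
      ∏ i, 1 / (n.1 i : ℝ) ^ k.get i := by
  rcases k with _ | ⟨a, l⟩
  · have : Finite (Fin ([] : List ℕ).length → ℕ) := inferInstanceAs (Finite (Fin 0 → ℕ))
    exact Summable.of_finite
  have ha : 2 ≤ a := h2 a (by simp)
  set r : ℝ := (l.length + 1 : ℝ) with hr
  have hr0 : 0 < r := by positivity
  have hs := summable_prod_tuple (fun n : ℕ => 1 / (n : ℝ) ^ (1 + 1 / r))
    (Real.summable_one_div_nat_rpow.2 (by simp [hr0])) (fun n => by positivity) (a :: l).length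
  refine Summable.of_nonneg_of_le (fun n => by positivity) (fun n => ?_)
    (hs.comp_injective Subtype.val_injective)
  obtain ⟨n, hn, h1⟩ := n
  have h1' : ∀ i, (1 : ℝ) ≤ n i := fun i => by exact_mod_cast h1 i
  have hp : ∀ i, (0 : ℝ) < n i := fun i => by linarith [h1' i]
  simp only [Function.comp, one_div, Finset.prod_inv_distrib]
  apply inv_anti₀ (Finset.prod_pos fun i _ => Real.rpow_pos_of_pos (hp i) _)
  simp only [Real.rpow_add (hp _), Real.rpow_one, Finset.prod_mul_distrib]
  have hA : ∏ i, (n i : ℝ) ^ r⁻¹ ≤ n ⟨0, by simp⟩ := by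
    calc ∏ i, (n i : ℝ) ^ r⁻¹ ≤ ∏ i : Fin (a :: l).length, (n ⟨0, by simp⟩ : ℝ) ^ r⁻¹ := by
          refine Finset.prod_le_prod (fun i _ => by positivity) fun i _ => ?_
          refine Real.rpow_le_rpow (hp i).le ?_ (by positivity)
          exact_mod_cast hn.antitone (Fin.mk_le_of_le_val (Nat.zero_le _))
      _ = n ⟨0, by simp⟩ := by
          rw [Finset.prod_const, Finset.card_univ, Fintype.card_fin, ← Real.rpow_natCast,
            ← Real.rpow_mul (hp _).le]
          have : r⁻¹ * ((a :: l).length : ℝ) = 1 := by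
            rw [List.length_cons]; push_cast; exact inv_mul_cancel₀ hr0.ne'
          rw [this, Real.rpow_one]
  refine (mul_le_mul_of_nonneg_left hA (Finset.prod_nonneg fun i _ => (hp i).le)).trans ?_
  change (∏ i : Fin (l.length + 1), (n i : ℝ)) * n 0 ≤
    ∏ i : Fin (l.length + 1), (n i : ℝ) ^ (a :: l).get i
  rw [Fin.prod_univ_succ, Fin.prod_univ_succ, mul_right_comm]
  refine mul_le_mul ?_ ?_ (Finset.prod_nonneg fun i _ => (hp _).le) (by positivity)
  · rw [← sq]; exact pow_le_pow_right₀ (h1' _) ha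
  · refine Finset.prod_le_prod (fun i _ => (hp _).le) fun i _ => ?_
    exact le_self_pow₀ (h1' _) (by have := hpos ((a :: l).get i.succ) (List.get_mem _ _); omega)

/-- `(a₁, …, a_p) + (b₁, …, b_q) = (a₁, …, a_{p-1}, a_p + b₁, b₂, …, b_q)`: join two lists,
putting a plus instead of a comma between the last entry of the first list and the first entry of
the second one. -/
def plusJoin : List ℕ → List ℕ → List ℕ
  | [], l => l
  | [a], [] => [a]
  | [a], b :: l => (a + b) :: l
  | a :: a' :: l, l' => a :: plusJoin (a' :: l) l'

/-- Hoffman's dual index: `(1, …, 1 + 1, …, 1 + ⋯ + 1, …, 1)`, with `k₁` ones in the first block,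
`k₂` ones in the second block, and so on, consecutive blocks being joined by a plus. -/
def hoffmanDual : List ℕ → List ℕ
  | [] => []
  | a :: l => plusJoin (List.replicate a 1) (hoffmanDual l)

/-- `(k₁ + e₁, …, kᵣ + eᵣ)`. -/
def addTuple (k : List ℕ) (e : Fin k.length → ℕ) : List ℕ :=
  List.ofFn fun i => k.get i + e i

/-!
Replacing every `1 / n^k` by `1 / ((n - x) n^(k-1)) = ∑ₑ xᵉ / n^(k+e)` turns a multiple zeta value
into the generating function in `x` of its Ohno sums. For `0 ≤ x < 1` these deformed values satisfy
duality, by the method of Seki and Yamamoto: two nested sums are multiplied and joined by the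
connector `P_m P_n / P_{m+n}`, where `P_n = (1 - x) ⋯ (n - x)`. A telescoping sum moves the
letters of the word of an index one at a time from one nested sum to the other, which reverses the
word and exchanges the two letters. Comparing coefficients of `x` equates the Ohno sums of
`(k₁ + 1, k₂, …, kᵣ)` and of the reverse of `k^∨` with its first entry raised by one, and duality at
`x = 0` rewrites each term of the latter as `ζ((1, …)^∨)`.
-/

open scoped ENNReal

theorem eq_of_forall_hasSum_mul_pow {a b : ℕ → ℝ} {f : ℝ → ℝ} {r : ℝ} (hr : 0 < r)
    (ha : ∀ x ∈ Set.Ioo 0 r, HasSum (fun n => a n * x ^ n) (f x))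
    (hb : ∀ x ∈ Set.Ioo 0 r, HasSum (fun n => b n * x ^ n) (f x)) : a = b := by
  have hab : ∀ x ∈ Set.Ioo 0 r, HasSum (fun n => (a - b) n * x ^ n) 0 := fun x hx => by
    simpa only [Pi.sub_apply, sub_mul, sub_self] using (ha x hx).sub (hb x hx)
  set p := FormalMultilinearSeries.ofScalars ℝ (a - b) with hp
  have hradius : 0 < p.radius := by
    obtain ⟨ρ, hρ, hρr⟩ := exists_between hr
    lift ρ to NNReal using hρ.le
    refine lt_of_lt_of_le (by exact_mod_cast hρ) (p.le_radius_of_summable_norm (r := ρ) ?_)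
    simpa [hp, abs_mul] using (hab ρ ⟨hρ, hρr⟩).summable.abs
  have hseries := (p.hasFPowerSeriesOnBall hradius).hasFPowerSeriesAt
  have hzero : ∀ᶠ x in nhdsWithin 0 (Set.Ioi 0), p.sum x = 0 := by
    filter_upwards [Ioo_mem_nhdsGT hr] with x hx
    simpa [hp, FormalMultilinearSeries.sum, mul_comm] using (hab x hx).tsum_eq
  have hlocally : ∀ᶠ x in nhds 0, p.sum x = 0 :=
    hseries.analyticAt.frequently_zero_iff_eventually_zero.1
      (hzero.frequently.filter_mono (nhdsWithin_mono _ fun _ hx => ne_of_gt hx))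
  exact sub_eq_zero.1 <|
    (FormalMultilinearSeries.ofScalars_series_eq_zero ℝ).1 (hseries.eq_zero_of_eventually hlocally)

theorem prod_tsum_eq_tsum_prod {r : ℕ} (f : Fin r → ℕ → ℝ≥0∞) :
    ∏ i, ∑' j, f i j = ∑' e : Fin r → ℕ, ∏ i, f i (e i) := by
  induction r with
  | zero => simp [tsum_fintype]
  | succ r ih =>
    rw [Fin.prod_univ_succ, ih, ← (Fin.consEquiv fun _ => ℕ).tsum_eq, ENNReal.tsum_prod']
    simp only [Fin.consEquiv, Equiv.coe_fn_mk, Fin.prod_univ_succ, Fin.cons_zero, Fin.cons_succ,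
      ENNReal.tsum_mul_left, ENNReal.tsum_mul_right]

theorem tsum_mul_pow_sum (c : ℝ≥0∞) {r : ℕ} (f : (Fin r → ℕ) → ℝ≥0∞) :
    ∑' e, f e * c ^ (∑ i, e i) =
      ∑' m, (∑ e ∈ Finset.Nat.antidiagonalTuple r m, f e) * c ^ m := by
  rw [← (Finset.Nat.sigmaAntidiagonalTupleEquivTuple r).tsum_eq, ENNReal.tsum_sigma']
  refine tsum_congr fun m => ?_
  rw [Finset.sum_mul, ← Finset.tsum_subtype]
  refine tsum_congr fun e => ?_
  change f e * c ^ (∑ i, (e : Fin r → ℕ) i) = f e * c ^ m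
  rw [Finset.Nat.mem_antidiagonalTuple.1 e.2]

theorem tsum_mul_sum_range (f g : ℕ → ℝ≥0∞) :
    ∑' n, f n * ∑ i ∈ Finset.range n, g i = ∑' i, g i * ∑' j, f (i + j + 1) := by
  rw [tsum_eq_zero_add' ENNReal.summable]
  simp only [← ENNReal.tsum_mul_left]
  rw [← ENNReal.tsum_prod (f := fun i j => g i * f (i + j + 1)),
    ← Finset.HasAntidiagonal.sigmaAntidiagonalEquivProd.tsum_eq, ENNReal.tsum_sigma']
  simp only [Finset.range_zero, Finset.sum_empty, mul_zero, zero_add]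
  refine tsum_congr fun n => ?_
  refine Eq.trans ?_ (Finset.tsum_subtype (Finset.HasAntidiagonal.antidiagonal n)
    fun p => g p.1 * f (p.1 + p.2 + 1)).symm
  rw [Finset.Nat.sum_antidiagonal_eq_sum_range_succ_mk, Finset.mul_sum]
  refine Finset.sum_congr rfl fun i hi => ?_
  rw [Nat.add_sub_cancel' (Finset.mem_range_succ_iff.1 hi), mul_comm]

/-- The tuples `n₁ > ⋯ > nᵣ` of elements of `s`. -/
def strictAntiTuples {α : Type*} [Preorder α] (r : ℕ) (s : Set α) : Set (Fin r → α) :=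
  {n | StrictAnti n ∧ ∀ i, n i ∈ s}

theorem cons_mem_strictAntiTuples {α : Type*} [Preorder α] {r : ℕ} {s : Set α} {m : α}
    {n : Fin r → α} :
    (Fin.cons m n : Fin (r + 1) → α) ∈ strictAntiTuples (r + 1) s ↔
      m ∈ s ∧ n ∈ strictAntiTuples r (s ∩ Set.Iio m) := by
  simp only [strictAntiTuples, StrictAnti, Set.mem_ofPred_eq, Fin.forall_fin_succ, Fin.cons_zero,
    Fin.cons_succ, Fin.succ_lt_succ_iff, Fin.succ_pos, Fin.not_lt_zero, forall_const,
    false_imp_iff, true_and, Set.mem_inter_iff, Set.mem_Iio, forall_and]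
  tauto

theorem tsum_strictAntiTuples_succ {α : Type*} [Preorder α] {r : ℕ} (s : Set α)
    (f : (Fin (r + 1) → α) → ℝ≥0∞) :
    ∑' n : strictAntiTuples (r + 1) s, f n =
      ∑' m : s, ∑' n : strictAntiTuples r (s ∩ Set.Iio (m : α)), f (Fin.cons m.1 n.1) := by
  classical
  rw [tsum_subtype, ← (Fin.consEquiv fun _ => α).tsum_eq, ENNReal.tsum_prod',
    tsum_subtype s fun m => ∑' n : strictAntiTuples r (s ∩ Set.Iio m), f (Fin.cons m n.1)]
  refine tsum_congr fun m => ?_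
  rw [Set.indicator_apply, tsum_subtype _ fun n => f (Fin.cons m n)]
  split_ifs with hm <;>
    simp [Set.indicator_apply, Fin.consEquiv, cons_mem_strictAntiTuples, hm]

theorem tsum_ofReal_sub_succ {f : ℕ → ℝ} (hf : Antitone f)
    (hlim : Filter.Tendsto f Filter.atTop (nhds 0)) :
    ∑' n, ENNReal.ofReal (f n - f (n + 1)) = ENNReal.ofReal (f 0) := by
  have hnonneg : ∀ n, 0 ≤ f n - f (n + 1) := fun n => sub_nonneg.2 (hf n.le_succ)
  have hsum : HasSum (fun n => f n - f (n + 1)) (f 0) := by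
    rw [hasSum_iff_tendsto_nat_of_nonneg hnonneg]
    simpa only [Finset.sum_range_sub', sub_zero] using hlim.const_sub (f 0)
  rw [← ENNReal.ofReal_tsum_of_nonneg hnonneg hsum.summable, hsum.tsum_eq]

/-- The connector `P_m P_n / P_{m+n}` of Seki and Yamamoto, where `P_n = (1 - x) ⋯ (n - x)`. -/
noncomputable def connector (x : ℝ) (m n : ℕ) : ℝ :=
  (ascPochhammer ℝ m).eval (1 - x) * (ascPochhammer ℝ n).eval (1 - x) /
    (ascPochhammer ℝ (m + n)).eval (1 - x)

theorem connector_comm (x : ℝ) (m n : ℕ) : connector x m n = connector x n m := by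
  simp only [connector, add_comm m n, mul_comm]

section Connector

variable {x : ℝ} (hx : x < 1)
include hx

theorem connector_zero_right (m : ℕ) : connector x m 0 = 1 := by
  simp [connector, (ascPochhammer_pos m _ (sub_pos.2 hx)).ne']

theorem connector_nonneg (m n : ℕ) : 0 ≤ connector x m n := by
  have hP := fun k => (ascPochhammer_pos k _ (sub_pos.2 hx)).le
  exact div_nonneg (mul_nonneg (hP m) (hP n)) (hP (m + n))

theorem natCast_succ_sub_pos (n : ℕ) : 0 < ((n + 1 : ℕ) : ℝ) - x := by
  have : (0 : ℝ) ≤ n := n.cast_nonneg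
  push_cast
  linarith

theorem connector_sub_connector_succ (m n : ℕ) :
    connector x m n - connector x m (n + 1) =
      m * (1 / ((n + 1 : ℕ) - x) * connector x m (n + 1)) := by
  have hP := (ascPochhammer_pos (m + n) _ (sub_pos.2 hx)).ne'
  have hn := (natCast_succ_sub_pos hx n).ne'
  have hmn := (natCast_succ_sub_pos hx (m + n)).ne'
  rw [connector, connector, ← add_assoc, ascPochhammer_succ_eval, ascPochhammer_succ_eval]
  push_cast at hn hmn ⊢
  rw [show 1 - x + (n : ℝ) = n + 1 - x by ring,
    show 1 - x + ((m : ℝ) + n) = m + n + 1 - x by ring]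
  field_simp
  ring

theorem connector_antitone (m : ℕ) : Antitone (connector x m) := by
  refine antitone_nat_of_succ_le fun n => ?_
  rw [← sub_nonneg, connector_sub_connector_succ hx]
  have := connector_nonneg hx m (n + 1)
  have := natCast_succ_sub_pos hx n
  positivity

theorem connector_one_left (n : ℕ) : connector x 1 n = (1 - x) * (1 / ((n + 1 : ℕ) - x)) := by
  have hP := (ascPochhammer_pos n _ (sub_pos.2 hx)).ne'
  have hn := (natCast_succ_sub_pos hx n).ne'
  rw [connector, add_comm 1 n, ascPochhammer_one, Polynomial.eval_X, ascPochhammer_succ_eval,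
    show 1 - x + (n : ℝ) = (n + 1 : ℕ) - x by push_cast; ring]
  field_simp

theorem tendsto_connector {m : ℕ} (hm : m ≠ 0) :
    Filter.Tendsto (connector x m) Filter.atTop (nhds 0) := by
  have hle : ∀ n, connector x m n ≤ connector x 1 n := fun n => by
    simpa only [connector_comm x n] using connector_antitone hx n (Nat.one_le_iff_ne_zero.2 hm)
  refine squeeze_zero (fun n => connector_nonneg hx m n) hle ?_
  have hinv : Filter.Tendsto (fun n : ℕ => 1 / (((n + 1 : ℕ) : ℝ) - x)) Filter.atTop (nhds 0) := by
    simp only [one_div]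
    exact (Filter.tendsto_atTop_add_const_right _ (-x)
      (tendsto_natCast_atTop_atTop.comp (Filter.tendsto_add_atTop_nat 1))).inv_tendsto_atTop
  simpa only [funext (connector_one_left hx), mul_zero] using hinv.const_mul (1 - x)

theorem tsum_one_div_sub_mul_connector {m : ℕ} (hm : m ≠ 0) (n : ℕ) :
    ∑' j : ℕ, ENNReal.ofReal (1 / ((n + j + 1 : ℕ) - x)) *
        ENNReal.ofReal (connector x m (n + j + 1)) =
      ENNReal.ofReal (1 / m) * ENNReal.ofReal (connector x m n) := by
  have hantitone : Antitone fun j => connector x m (n + j) :=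
    fun i j hij => connector_antitone hx m (Nat.add_le_add_left hij n)
  have hlim : Filter.Tendsto (fun j => connector x m (n + j)) Filter.atTop (nhds 0) := by
    simpa only [add_comm n, Function.comp_def] using
      (tendsto_connector hx hm).comp (Filter.tendsto_add_atTop_nat n)
  have htelescope := tsum_ofReal_sub_succ hantitone hlim
  rw [add_zero] at htelescope
  rw [← htelescope, ← ENNReal.tsum_mul_left]
  refine tsum_congr fun j => ?_
  have hm' : (m : ℝ) ≠ 0 := Nat.cast_ne_zero.2 hm
  rw [← ENNReal.ofReal_mul (one_div_nonneg.2 (natCast_succ_sub_pos hx _).le),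
    ← ENNReal.ofReal_mul (one_div_nonneg.2 m.cast_nonneg), ← add_assoc,
    connector_sub_connector_succ hx, one_div (m : ℝ), inv_mul_cancel_left₀ hm']

end Connector

/-- The nested sum with largest variable `m` of a list of separators, in which `true` divides by
the current variable `m` and `false` weighs it by `1 / (m - x)` and opens a smaller one. In the
usual encoding of indices by words in two letters these are the two letters, and the last letter,
always a `false`, is left out. -/
noncomputable def wordSum (x : ℝ) : List Bool → ℕ → ℝ≥0∞
  | [], m => ENNReal.ofReal (1 / (m - x))
  | true :: w, m => ENNReal.ofReal (1 / m) * wordSum x w m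
  | false :: w, m => ENNReal.ofReal (1 / (m - x)) * ∑ n ∈ Finset.range m, wordSum x w n

/-- The nested sums of two words, joined by the connector of their largest variables. -/
noncomputable def connectedSum (x : ℝ) (u v : List Bool) : ℝ≥0∞ :=
  ∑' m, ∑' n, wordSum x u m * wordSum x v n * ENNReal.ofReal (connector x m n)

theorem connectedSum_comm (x : ℝ) (u v : List Bool) :
    connectedSum x u v = connectedSum x v u := by
  rw [connectedSum, connectedSum, ENNReal.tsum_comm]
  simp only [connector_comm x, mul_comm (wordSum x u _)]

section Duality

variable {x : ℝ} (hx0 : 0 ≤ x)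
include hx0

theorem wordSum_zero (w : List Bool) : wordSum x w 0 = 0 := by
  induction w with
  | nil =>
    -- `1 / (0 - x)` is negative or `1 / 0`, and `ofReal` sends both to `0`
    simpa [wordSum] using hx0
  | cons b w ih => cases b <;> simp [wordSum, ih]

variable (hx : x < 1)
include hx

theorem connectedSum_true_cons (u v : List Bool) :
    connectedSum x (true :: u) v = connectedSum x u (false :: v) := by
  refine tsum_congr fun m => ?_
  rcases eq_or_ne m 0 with rfl | hm
  · simp only [wordSum_zero hx0, zero_mul]
  calc ∑' n, wordSum x (true :: u) m * wordSum x v n * ENNReal.ofReal (connector x m n)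
      = ∑' n, wordSum x u m * (wordSum x v n *
          (ENNReal.ofReal (1 / m) * ENNReal.ofReal (connector x m n))) := by
        refine tsum_congr fun n => ?_
        rw [wordSum]
        ring
    _ = wordSum x u m * ∑' n : ℕ, ENNReal.ofReal (1 / (n - x)) * ENNReal.ofReal (connector x m n) *
          ∑ i ∈ Finset.range n, wordSum x v i := by
        rw [tsum_mul_sum_range, ENNReal.tsum_mul_left]
        simp only [tsum_one_div_sub_mul_connector hx hm]
    _ = ∑' n, wordSum x u m * wordSum x (false :: v) n * ENNReal.ofReal (connector x m n) := by
        rw [← ENNReal.tsum_mul_left]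
        refine tsum_congr fun n => ?_
        rw [wordSum]
        ring

theorem tsum_wordSum_true_cons (u : List Bool) :
    ∑' m, wordSum x (true :: u) m = connectedSum x u [] := by
  refine tsum_congr fun m => ?_
  rcases eq_or_ne m 0 with rfl | hm
  · simp only [wordSum_zero hx0, zero_mul, tsum_zero]
  have hboundary := tsum_one_div_sub_mul_connector hx hm 0
  rw [connector_zero_right hx, ENNReal.ofReal_one, mul_one] at hboundary
  simp only [mul_assoc, ENNReal.tsum_mul_left]
  rw [tsum_eq_zero_add' ENNReal.summable, wordSum_zero hx0, zero_mul, zero_add, wordSum,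
    ← hboundary, mul_comm]
  simp only [wordSum, zero_add]

theorem connectedSum_eq_connectedSum_nil (u v : List Bool) :
    connectedSum x u v = connectedSum x [] ((u.map (!·)).reverse ++ v) := by
  induction u generalizing v with
  | nil => rfl
  | cons b u ih =>
    rw [List.map_cons, List.reverse_cons, List.append_assoc, List.singleton_append, ← ih]
    cases b
    · rw [connectedSum_comm, ← connectedSum_true_cons hx0 hx, connectedSum_comm, Bool.not_false]
    · rw [connectedSum_true_cons hx0 hx, Bool.not_true]

theorem tsum_wordSum_duality (w : List Bool) :
    ∑' m, wordSum x (true :: w) m = ∑' m, wordSum x (true :: (w.map (!·)).reverse) m := by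
  rw [tsum_wordSum_true_cons hx0 hx, tsum_wordSum_true_cons hx0 hx,
    connectedSum_eq_connectedSum_nil hx0 hx w, List.append_nil, connectedSum_comm]

end Duality

/-- The separators between the ones of an index with all entries written as sums of ones: `true`
for a plus sign, `false` for a comma. -/
def separators : List ℕ → List Bool
  | [] => []
  | [a] => List.replicate (a - 1) true
  | a :: b :: l => List.replicate (a - 1) true ++ false :: separators (b :: l)

theorem separators_cons (a : ℕ) {l : List ℕ} (hl : l ≠ []) :
    separators (a :: l) = List.replicate (a - 1) true ++ false :: separators l := by
  obtain ⟨b, l, rfl⟩ := List.exists_cons_of_ne_nil hl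
  rfl

theorem separators_append {u v : List ℕ} (hu : u ≠ []) (hv : v ≠ []) :
    separators (u ++ v) = separators u ++ false :: separators v := by
  induction u with
  | nil => contradiction
  | cons a u ih =>
    rcases eq_or_ne u [] with rfl | hu'
    · exact separators_cons a hv
    · rw [List.cons_append, separators_cons a (List.append_ne_nil_of_left_ne_nil hu' v), ih hu',
        separators_cons a hu', List.append_assoc, List.cons_append]

theorem separators_reverse (k : List ℕ) : separators k.reverse = (separators k).reverse := by
  induction k with
  | nil => rfl
  | cons a l ih =>
    rcases eq_or_ne l [] with rfl | hl
    · simp [separators]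
    · rw [List.reverse_cons,
        separators_append (List.reverse_ne_nil_iff.2 hl) (List.cons_ne_nil a []), ih,
        separators_cons a hl]
      simp [separators]

theorem separators_modifyHead_succ {k : List ℕ} (hne : k ≠ []) (hpos : ∀ a ∈ k, 1 ≤ a) :
    separators (k.modifyHead (· + 1)) = true :: separators k := by
  obtain ⟨a, l, rfl⟩ := List.exists_cons_of_ne_nil hne
  have ha : a + 1 - 1 = a - 1 + 1 := by have := hpos a List.mem_cons_self; omega
  cases l <;> simp [separators, ha, List.replicate_succ]

theorem separators_replicate_one (a : ℕ) :
    separators (List.replicate (a + 1) 1) = List.replicate a false := by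
  induction a with
  | zero => rfl
  | succ a ih =>
    rw [List.replicate_succ, separators_cons 1 (by simp), ih]
    rfl

theorem plusJoin_nil (u : List ℕ) : plusJoin u [] = u := by
  induction u with
  | nil => rfl
  | cons a u ih =>
    cases u with
    | nil => rfl
    | cons b u => rw [plusJoin, ih]

theorem plusJoin_ne_nil {u : List ℕ} (hu : u ≠ []) (v : List ℕ) : plusJoin u v ≠ [] := by
  rcases u with _ | ⟨a, _ | ⟨b, u⟩⟩
  · contradiction
  · cases v <;> simp [plusJoin]
  · simp [plusJoin]

theorem plusJoin_pos {u v : List ℕ} (hu : ∀ a ∈ u, 1 ≤ a) (hv : ∀ a ∈ v, 1 ≤ a) :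
    ∀ a ∈ plusJoin u v, 1 ≤ a := by
  induction u with
  | nil => exact hv
  | cons a u ih =>
    obtain ⟨ha, hu⟩ := List.forall_mem_cons.1 hu
    cases u with
    | nil =>
      cases v with
      | nil => simpa [plusJoin] using ha
      | cons b v =>
        exact List.forall_mem_cons.2 ⟨Nat.le_add_right_of_le ha, (List.forall_mem_cons.1 hv).2⟩
    | cons b u => exact List.forall_mem_cons.2 ⟨ha, ih hu⟩

theorem separators_plusJoin {u v : List ℕ} (hu : u ≠ []) (hv : v ≠ [])
    (hupos : ∀ a ∈ u, 1 ≤ a) (hvpos : ∀ a ∈ v, 1 ≤ a) :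
    separators (plusJoin u v) = separators u ++ true :: separators v := by
  induction u with
  | nil => contradiction
  | cons a u ih =>
    obtain ⟨ha, hupos⟩ := List.forall_mem_cons.1 hupos
    cases u with
    | nil =>
      obtain ⟨b, v, rfl⟩ := List.exists_cons_of_ne_nil hv
      have hb := hvpos b List.mem_cons_self
      have hab : a + b - 1 = a - 1 + (b - 1 + 1) := by omega
      cases v <;> simp [plusJoin, separators, hab, List.replicate_add, List.replicate_succ]
    | cons c u =>
      have hcu := List.cons_ne_nil c u
      rw [plusJoin, separators_cons a (plusJoin_ne_nil hcu v), ih hcu hupos, separators_cons a hcu,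
        List.append_assoc, List.cons_append]

theorem hoffmanDual_ne_nil {k : List ℕ} (hne : k ≠ []) (hpos : ∀ a ∈ k, 1 ≤ a) :
    hoffmanDual k ≠ [] := by
  obtain ⟨a, l, rfl⟩ := List.exists_cons_of_ne_nil hne
  have ha := hpos a List.mem_cons_self
  exact plusJoin_ne_nil (by simp only [ne_eq, List.replicate_eq_nil_iff]; omega) _

theorem hoffmanDual_pos (k : List ℕ) : ∀ a ∈ hoffmanDual k, 1 ≤ a := by
  induction k with
  | nil => simp [hoffmanDual]
  | cons a l ih => exact plusJoin_pos (fun b hb => (List.eq_of_mem_replicate hb).ge) ih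

theorem separators_hoffmanDual {k : List ℕ} (hpos : ∀ a ∈ k, 1 ≤ a) :
    separators (hoffmanDual k) = (separators k).map (!·) := by
  induction k with
  | nil => rfl
  | cons a l ih =>
    obtain ⟨ha, hlpos⟩ := List.forall_mem_cons.1 hpos
    obtain ⟨b, rfl⟩ := Nat.exists_eq_add_of_le' ha
    rcases eq_or_ne l [] with rfl | hl
    · simp [hoffmanDual, plusJoin_nil, separators_replicate_one, separators]
    · rw [hoffmanDual, separators_plusJoin (u := List.replicate (b + 1) 1) (by simp)
          (hoffmanDual_ne_nil hl hlpos) (fun c hc => (List.eq_of_mem_replicate hc).ge)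
          (hoffmanDual_pos l), ih hlpos, separators_replicate_one, separators_cons _ hl]
      simp

theorem hoffmanDual_one_cons {l : List ℕ} (hne : l ≠ []) (hpos : ∀ a ∈ l, 1 ≤ a) :
    hoffmanDual (1 :: l) = (hoffmanDual l).modifyHead (· + 1) := by
  obtain ⟨b, d, hd⟩ := List.exists_cons_of_ne_nil (hoffmanDual_ne_nil hne hpos)
  rw [hoffmanDual, hd, List.modifyHead_cons, add_comm b 1]
  rfl

/-- The weight `1 / ((m - x) m^(a-1))`, which replaces `1 / m^a` in the deformed multiple zeta
values. -/
noncomputable def deformedWeight (x : ℝ) (a m : ℕ) : ℝ≥0∞ :=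
  ENNReal.ofReal (1 / ((m - x) * m ^ (a - 1)))

theorem deformedWeight_eq_mul (x : ℝ) (a m : ℕ) :
    deformedWeight x a m = ENNReal.ofReal (1 / m ^ (a - 1)) * ENNReal.ofReal (1 / (m - x)) := by
  rw [← ENNReal.ofReal_mul (by positivity), one_div_mul_one_div, mul_comm, deformedWeight]

theorem deformedWeight_zero {a : ℕ} (ha : 1 ≤ a) (m : ℕ) :
    deformedWeight 0 a m = ENNReal.ofReal (1 / m ^ a) := by
  rw [deformedWeight, sub_zero, mul_pow_sub_one (Nat.one_le_iff_ne_zero.1 ha)]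

theorem deformedWeight_eq_tsum {x : ℝ} (hx0 : 0 ≤ x) (hx : x < 1) {a m : ℕ} (ha : 1 ≤ a)
    (hm : 1 ≤ m) :
    deformedWeight x a m = ∑' i, deformedWeight 0 (a + i) m * ENNReal.ofReal x ^ i := by
  have hm1 : (1 : ℝ) ≤ m := Nat.one_le_cast.2 hm
  have hm0 : (0 : ℝ) < m := zero_lt_one.trans_le hm1
  have hmx : (m : ℝ) - x ≠ 0 := by linarith
  have hratio : x / m < 1 := (div_lt_one hm0).2 (by linarith)
  have hgeometric :=
    (hasSum_geometric_of_lt_one (div_nonneg hx0 hm0.le) hratio).mul_left (1 / (m : ℝ) ^ a)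
  have hvalue : 1 / (m : ℝ) ^ a * (1 - x / m)⁻¹ = 1 / ((m - x) * m ^ (a - 1)) := by
    rw [← mul_pow_sub_one (Nat.one_le_iff_ne_zero.1 ha)]
    field_simp
  rw [deformedWeight, ← hvalue, ← hgeometric.tsum_eq,
    ENNReal.ofReal_tsum_of_nonneg (fun i => by positivity) hgeometric.summable]
  refine tsum_congr fun i => ?_
  rw [deformedWeight_zero (Nat.le_add_right_of_le ha), ← ENNReal.ofReal_pow hx0,
    ← ENNReal.ofReal_mul (by positivity), div_pow, pow_add]
  congr 1
  field_simp

theorem deformedWeight_le {x : ℝ} (hx0 : 0 ≤ x) (hx : x < 1) (a : ℕ) {m : ℕ} (hm : 1 ≤ m) :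
    deformedWeight x a m ≤ ENNReal.ofReal (1 / (1 - x)) * deformedWeight 0 a m := by
  have hm1 : (1 : ℝ) ≤ m := Nat.one_le_cast.2 hm
  have hx' : 0 < 1 - x := sub_pos.2 hx
  have hle : (1 - x) * m ≤ m - x := by nlinarith
  rw [deformedWeight, deformedWeight, ← ENNReal.ofReal_mul (one_div_nonneg.2 hx'.le), sub_zero,
    one_div_mul_one_div, ← mul_assoc]
  gcongr

/-- The sum of `∏ 1 / ((nᵢ - x) nᵢ^(kᵢ-1))` over the tuples `n₁ > ⋯ > nᵣ` of elements of `s`. For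
`x = 0` and `s = [1, ∞)` this is the multiple zeta value of `k`, and for `s = [1, m)` a truncation
of it. -/
noncomputable def deformedMzv (x : ℝ) {r : ℕ} (k : Fin r → ℕ) (s : Set ℕ) : ℝ≥0∞ :=
  ∑' n : strictAntiTuples r s, ∏ i, deformedWeight x (k i) (n.1 i)

theorem deformedMzv_fin_zero (x : ℝ) (k : Fin 0 → ℕ) (s : Set ℕ) : deformedMzv x k s = 1 := by
  have : Unique (strictAntiTuples 0 s) :=
    { default := ⟨finZeroElim, fun i => i.elim0, fun i => i.elim0⟩
      uniq := fun n => Subtype.ext (Subsingleton.elim _ _) }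
  simp [deformedMzv, tsum_fintype]

theorem deformedMzv_succ (x : ℝ) {r : ℕ} (k : Fin (r + 1) → ℕ) (s : Set ℕ) :
    deformedMzv x k s =
      ∑' m : s, deformedWeight x (k 0) m * deformedMzv x (Fin.tail k) (s ∩ Set.Iio (m : ℕ)) := by
  rw [deformedMzv, tsum_strictAntiTuples_succ s fun n => ∏ i, deformedWeight x (k i) (n i)]
  simp only [Fin.prod_univ_succ, Fin.cons_zero, Fin.cons_succ, ENNReal.tsum_mul_left]
  rfl

theorem deformedMzv_ofFn (x : ℝ) {r : ℕ} (k : Fin r → ℕ) (s : Set ℕ) :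
    deformedMzv x (List.ofFn k).get s = deformedMzv x k s := by
  have hcast : ∀ {r'} (h : r' = r), deformedMzv x (k ∘ Fin.cast h) s = deformedMzv x k s := by
    rintro _ rfl
    rfl
  rw [← hcast (List.length_ofFn (f := k))]
  congr 1
  exact funext fun i => List.get_ofFn k i

theorem wordSum_replicate_true_append (x : ℝ) (b : ℕ) (w : List Bool) (m : ℕ) :
    wordSum x (List.replicate b true ++ w) m = ENNReal.ofReal (1 / m ^ b) * wordSum x w m := by
  induction b with
  | zero => simp
  | succ b ih =>
    rw [List.replicate_succ, List.cons_append, wordSum, ih, ← mul_assoc,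
      ← ENNReal.ofReal_mul (by positivity), one_div_mul_one_div, pow_succ']

section Deformation

variable {x : ℝ} (hx0 : 0 ≤ x)
include hx0

theorem wordSum_separators_cons (a : ℕ) (l : List ℕ) (m : ℕ) :
    wordSum x (separators (a :: l)) m =
      deformedWeight x a m * deformedMzv x l.get (Set.Ico 1 m) := by
  induction l generalizing a m with
  | nil =>
    rw [deformedMzv_fin_zero, mul_one, deformedWeight_eq_mul, separators,
      ← List.append_nil (.replicate _ _), wordSum_replicate_true_append, wordSum]
  | cons b l ih =>
    have hinner : ∑ n ∈ Finset.range m, wordSum x (separators (b :: l)) n =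
        deformedMzv x (b :: l).get (Set.Ico 1 m) := by
      rw [← Finset.sum_subset (s₁ := Finset.Ico 1 m) (fun n hn => by simp_all) fun n _ hn => ?_,
        ← Finset.tsum_subtype', Finset.coe_Ico, deformedMzv_succ]
      · refine tsum_congr fun n => ?_
        rw [ih, Set.Ico_inter_Iio, min_eq_right n.2.2.le]
        rfl
      · obtain rfl : n = 0 := by simp_all
        exact wordSum_zero hx0 _
    rw [separators, wordSum_replicate_true_append, wordSum, hinner, ← mul_assoc,
      deformedWeight_eq_mul]

theorem tsum_wordSum_separators {k : List ℕ} (hne : k ≠ []) :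
    ∑' m, wordSum x (separators k) m = deformedMzv x k.get (Set.Ici 1) := by
  obtain ⟨a, l, rfl⟩ := List.exists_cons_of_ne_nil hne
  have hsupport : Function.support (wordSum x (separators (a :: l))) ⊆ Set.Ici 1 :=
    fun m hm => Nat.one_le_iff_ne_zero.2 fun h => hm (h ▸ wordSum_zero hx0 _)
  rw [← tsum_subtype_eq_of_support_subset hsupport, deformedMzv_succ]
  refine tsum_congr fun m => ?_
  rw [wordSum_separators_cons hx0, Set.Ici_inter_Iio]
  rfl

variable (hx : x < 1)
include hx

theorem deformedMzv_eq_tsum {r : ℕ} {k : Fin r → ℕ} (hk : ∀ i, 1 ≤ k i) {s : Set ℕ}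
    (hs : s ⊆ Set.Ici 1) :
    deformedMzv x k s =
      ∑' N, (∑ e ∈ Finset.Nat.antidiagonalTuple r N, deformedMzv 0 (k + e) s) *
        ENNReal.ofReal x ^ N := by
  calc deformedMzv x k s
      = ∑' (n : strictAntiTuples r s), ∏ i, ∑' j,
          deformedWeight 0 (k i + j) (n.1 i) * ENNReal.ofReal x ^ j :=
        tsum_congr fun n => Finset.prod_congr rfl fun i _ =>
          deformedWeight_eq_tsum hx0 hx (hk i) (hs (n.2.2 i))
    _ = ∑' (n : strictAntiTuples r s) (e : Fin r → ℕ),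
          (∏ i, deformedWeight 0 (k i + e i) (n.1 i)) * ENNReal.ofReal x ^ (∑ i, e i) := by
        simp only [prod_tsum_eq_tsum_prod, Finset.prod_mul_distrib, Finset.prod_pow_eq_pow_sum]
    _ = ∑' e : Fin r → ℕ, deformedMzv 0 (k + e) s * ENNReal.ofReal x ^ (∑ i, e i) := by
        rw [ENNReal.tsum_comm]
        simp only [ENNReal.tsum_mul_right]
        rfl
    _ = _ := tsum_mul_pow_sum _ _

theorem deformedMzv_le {r : ℕ} (k : Fin r → ℕ) {s : Set ℕ} (hs : s ⊆ Set.Ici 1) :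
    deformedMzv x k s ≤ ENNReal.ofReal (1 / (1 - x)) ^ r * deformedMzv 0 k s := by
  rw [deformedMzv, deformedMzv, ← ENNReal.tsum_mul_left]
  refine ENNReal.tsum_le_tsum fun n => ?_
  calc ∏ i, deformedWeight x (k i) (n.1 i)
      ≤ ∏ i, ENNReal.ofReal (1 / (1 - x)) * deformedWeight 0 (k i) (n.1 i) :=
        Finset.prod_le_prod' fun i _ => deformedWeight_le hx0 hx (k i) (hs (n.2.2 i))
    _ = _ := by rw [Finset.prod_mul_distrib, Finset.prod_const, Finset.card_univ, Fintype.card_fin]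

end Deformation

theorem deformedMzv_zero_get {k : List ℕ} (hpos : ∀ a ∈ k, 1 ≤ a) :
    deformedMzv 0 k.get (Set.Ici 1) =
      ∑' n : {n : Fin k.length → ℕ // StrictAnti n ∧ ∀ i, 1 ≤ n i},
        ENNReal.ofReal (∏ i, 1 / (n.1 i : ℝ) ^ k.get i) := by
  refine tsum_congr fun n => ?_
  rw [ENNReal.ofReal_prod_of_nonneg fun i _ => by positivity]
  exact Finset.prod_congr rfl fun i _ => deformedWeight_zero (hpos _ (k.get_mem i)) _

theorem mzv_eq_toReal_deformedMzv {k : List ℕ} (hpos : ∀ a ∈ k, 1 ≤ a) :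
    mzv k = (deformedMzv 0 k.get (Set.Ici 1)).toReal := by
  rw [deformedMzv_zero_get hpos, ENNReal.tsum_toReal_eq fun n => ENNReal.ofReal_ne_top, mzv]
  exact tsum_congr fun n => (ENNReal.toReal_ofReal (by positivity)).symm

/-- The condition on an index under which the series defining its multiple zeta value converges. -/
def IsAdmissible (k : List ℕ) : Prop :=
  (∀ a ∈ k, 1 ≤ a) ∧ ∀ a ∈ k.head?, 2 ≤ a

theorem isAdmissible_modifyHead_succ {k : List ℕ} (hpos : ∀ a ∈ k, 1 ≤ a) :
    IsAdmissible (k.modifyHead (· + 1)) := by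
  cases k with
  | nil => simp [IsAdmissible]
  | cons a l =>
    obtain ⟨ha, hl⟩ := List.forall_mem_cons.1 hpos
    exact ⟨List.forall_mem_cons.2 ⟨Nat.le_add_left 1 a, hl⟩, by simpa using ha⟩

theorem addTuple_pos {k : List ℕ} (hpos : ∀ a ∈ k, 1 ≤ a) (e : Fin k.length → ℕ) :
    ∀ a ∈ addTuple k e, 1 ≤ a := by
  simp only [addTuple, List.mem_ofFn, forall_exists_index, forall_apply_eq_imp_iff]
  exact fun i => Nat.le_add_right_of_le (hpos _ (k.get_mem i))

theorem isAdmissible_addTuple {k : List ℕ} (hk : IsAdmissible k) (e : Fin k.length → ℕ) :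
    IsAdmissible (addTuple k e) := by
  refine ⟨addTuple_pos hk.1 e, ?_⟩
  cases k with
  | nil => simp [addTuple]
  | cons a l =>
    have ha : 2 ≤ a := hk.2 a rfl
    simpa [addTuple] using Nat.le_add_right_of_le ha

theorem IsAdmissible.deformedMzv_zero_ne_top {k : List ℕ} (hk : IsAdmissible k) :
    deformedMzv 0 k.get (Set.Ici 1) ≠ ∞ := by
  rw [deformedMzv_zero_get hk.1]
  exact (mzv_summable k hk.1 hk.2).tsum_ofReal_ne_top

/-- The sum of the multiple zeta values of `k + e` over all tuples `e` with sum `m`. -/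
noncomputable def ohnoSum (k : List ℕ) (m : ℕ) : ℝ :=
  ∑ e ∈ Finset.Nat.antidiagonalTuple k.length m, mzv (addTuple k e)

theorem IsAdmissible.hasSum_ohnoSum {k : List ℕ} (hk : IsAdmissible k) {x : ℝ} (hx0 : 0 ≤ x)
    (hx : x < 1) :
    HasSum (fun N => ohnoSum k N * x ^ N) (deformedMzv x k.get (Set.Ici 1)).toReal := by
  have hexpansion := deformedMzv_eq_tsum hx0 hx (fun i => hk.1 _ (k.get_mem i)) subset_rfl
  have hfinite : deformedMzv x k.get (Set.Ici 1) ≠ ∞ :=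
    ne_top_of_le_ne_top (ENNReal.mul_ne_top (by finiteness) hk.deformedMzv_zero_ne_top)
      (deformedMzv_le hx0 hx k.get subset_rfl)
  have hcoeff : ∀ N, ohnoSum k N = (∑ e ∈ Finset.Nat.antidiagonalTuple k.length N,
      deformedMzv 0 (k.get + e) (Set.Ici 1)).toReal := fun N => by
    have hterm : ∀ e, deformedMzv 0 (k.get + e) (Set.Ici 1) =
        deformedMzv 0 (addTuple k e).get (Set.Ici 1) := fun e => (deformedMzv_ofFn 0 _ _).symm
    simp only [hterm]
    rw [ENNReal.toReal_sum fun e _ => (isAdmissible_addTuple hk e).deformedMzv_zero_ne_top]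
    exact Finset.sum_congr rfl fun e _ => mzv_eq_toReal_deformedMzv (addTuple_pos hk.1 e)
  rw [hexpansion] at hfinite ⊢
  convert ENNReal.hasSum_toReal hfinite using 2 with N
  · rw [ENNReal.toReal_mul, ENNReal.toReal_pow, ENNReal.toReal_ofReal hx0, hcoeff]
  · exact ENNReal.tsum_toReal_eq fun N => ENNReal.ne_top_of_tsum_ne_top hfinite N

theorem deformedMzv_duality {x : ℝ} (hx0 : 0 ≤ x) (hx : x < 1) {k l : List ℕ} (hk : k ≠ [])
    (hkpos : ∀ a ∈ k, 1 ≤ a) (hl : l ≠ []) (hlpos : ∀ a ∈ l, 1 ≤ a)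
    (hkl : separators l = ((separators k).map (!·)).reverse) :
    deformedMzv x (k.modifyHead (· + 1)).get (Set.Ici 1) =
      deformedMzv x (l.modifyHead (· + 1)).get (Set.Ici 1) := by
  rw [← tsum_wordSum_separators hx0 (by simpa using hk),
    ← tsum_wordSum_separators hx0 (by simpa using hl), separators_modifyHead_succ hk hkpos,
    separators_modifyHead_succ hl hlpos, hkl, tsum_wordSum_duality hx0 hx]

theorem ohnoSum_duality {k : List ℕ} (hne : k ≠ []) (hpos : ∀ a ∈ k, 1 ≤ a) :
    ohnoSum (k.modifyHead (· + 1)) = ohnoSum ((hoffmanDual k).reverse.modifyHead (· + 1)) := by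
  have hne' := List.reverse_ne_nil_iff.2 (hoffmanDual_ne_nil hne hpos)
  have hpos' : ∀ a ∈ (hoffmanDual k).reverse, 1 ≤ a :=
    fun a ha => hoffmanDual_pos k a (List.mem_reverse.1 ha)
  have hseparators : separators (hoffmanDual k).reverse = ((separators k).map (!·)).reverse := by
    rw [separators_reverse, separators_hoffmanDual hpos]
  refine eq_of_forall_hasSum_mul_pow one_pos
    (fun x hx => (isAdmissible_modifyHead_succ hpos).hasSum_ohnoSum hx.1.le hx.2) fun x hx => ?_
  rw [deformedMzv_duality hx.1.le hx.2 hne hpos hne' hpos' hseparators]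
  exact (isAdmissible_modifyHead_succ hpos').hasSum_ohnoSum hx.1.le hx.2

theorem mzv_hoffmanDual_one_cons {l : List ℕ} (hne : l ≠ []) (hpos : ∀ a ∈ l, 1 ≤ a) :
    mzv (hoffmanDual (1 :: l)) = mzv (l.reverse.modifyHead (· + 1)) := by
  have hpos' : ∀ a ∈ l.reverse, 1 ≤ a := fun a ha => hpos a (List.mem_reverse.1 ha)
  have hseparators : separators l.reverse = ((separators (hoffmanDual l)).map (!·)).reverse := by
    simp [separators_reverse, separators_hoffmanDual hpos, Function.comp_def]
  rw [hoffmanDual_one_cons hne hpos,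
    mzv_eq_toReal_deformedMzv (isAdmissible_modifyHead_succ (hoffmanDual_pos l)).1,
    mzv_eq_toReal_deformedMzv (isAdmissible_modifyHead_succ hpos').1,
    deformedMzv_duality le_rfl zero_lt_one (hoffmanDual_ne_nil hne hpos) (hoffmanDual_pos l)
      (List.reverse_ne_nil_iff.2 hne) hpos' hseparators]

theorem modifyHead_succ_addTuple (a : ℕ) (l : List ℕ) (e : Fin (a :: l).length → ℕ) :
    (addTuple (a :: l) e).modifyHead (· + 1) = addTuple ((a + 1) :: l) e := by
  simp [addTuple, add_right_comm a]

theorem sum_mzv_modifyHead_addTuple {k : List ℕ} (hne : k ≠ []) (m : ℕ) :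
    ∑ e ∈ Finset.Nat.antidiagonalTuple k.length m, mzv ((addTuple k e).modifyHead (· + 1)) =
      ohnoSum (k.modifyHead (· + 1)) m := by
  obtain ⟨a, l, rfl⟩ := List.exists_cons_of_ne_nil hne
  exact Finset.sum_congr rfl fun e _ => congrArg mzv (modifyHead_succ_addTuple a l e)

theorem sum_addTuple_reverse {M : Type*} [AddCommMonoid M] (k : List ℕ) (m : ℕ)
    (F : List ℕ → M) :
    ∑ e ∈ Finset.Nat.antidiagonalTuple k.reverse.length m, F (addTuple k.reverse e) =
      ∑ e ∈ Finset.Nat.antidiagonalTuple k.length m, F (addTuple k e).reverse := by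
  let σ : Fin k.reverse.length ≃ Fin k.length := (finCongr k.length_reverse).trans Fin.revPerm
  have hreverse : ∀ e, (addTuple k e).reverse = addTuple k.reverse (e ∘ σ) := fun e => by
    refine List.ext_getElem (by simp [addTuple]) fun i hi _ => ?_
    have hik : i < k.length := by simpa [addTuple] using hi
    have hrev : e ⟨k.length - 1 - i, by omega⟩ = e (Fin.rev ⟨i, hik⟩) :=
      congrArg e (Fin.ext (by simp only [Fin.val_rev, Nat.sub_sub, add_comm 1]))
    simpa [addTuple, σ] using hrev
  refine (Finset.sum_equiv (σ.symm.arrowCongr (.refl ℕ)) (fun e => ?_) fun e _ => ?_).symm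
  · simp only [Finset.Nat.mem_antidiagonalTuple]
    exact Eq.congr_left (σ.sum_comp e).symm
  · exact congrArg F (hreverse e)

theorem theorem2p2 (k : List ℕ) (hne : k ≠ []) (hpos : ∀ a ∈ k, 1 ≤ a) (m : ℕ) :
    ∑ e ∈ Finset.Nat.antidiagonalTuple k.length m,
        mzv ((addTuple k e).modifyHead (· + 1)) =
      ∑ e ∈ Finset.Nat.antidiagonalTuple (hoffmanDual k).length m,
        mzv (hoffmanDual (1 :: addTuple (hoffmanDual k) e)) := by
  have hdual := hoffmanDual_ne_nil hne hpos
  calc ∑ e ∈ Finset.Nat.antidiagonalTuple k.length m, mzv ((addTuple k e).modifyHead (· + 1))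
      = ohnoSum (k.modifyHead (· + 1)) m := sum_mzv_modifyHead_addTuple hne m
    _ = ohnoSum ((hoffmanDual k).reverse.modifyHead (· + 1)) m := by
        rw [ohnoSum_duality hne hpos]
    _ = ∑ e ∈ Finset.Nat.antidiagonalTuple (hoffmanDual k).reverse.length m,
          mzv ((addTuple (hoffmanDual k).reverse e).modifyHead (· + 1)) :=
        (sum_mzv_modifyHead_addTuple (List.reverse_ne_nil_iff.2 hdual) m).symm
    _ = ∑ e ∈ Finset.Nat.antidiagonalTuple (hoffmanDual k).length m,
          mzv ((addTuple (hoffmanDual k) e).reverse.modifyHead (· + 1)) :=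
        sum_addTuple_reverse _ m fun l => mzv (l.modifyHead (· + 1))
    _ = ∑ e ∈ Finset.Nat.antidiagonalTuple (hoffmanDual k).length m,
          mzv (hoffmanDual (1 :: addTuple (hoffmanDual k) e)) :=
        Finset.sum_congr rfl fun e _ =>
          (mzv_hoffmanDual_one_cons (by simpa [addTuple] using hdual)
            (addTuple_pos (hoffmanDual_pos k) e)).symm
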